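/- Let $A$ be a finite alphabet, $A^*$ the set of finite words over $A$, and $\sigma\colon A^*\to A^*$ a substitution, i.e. a map with $\sigma(uv)=\sigma(u)\sigma(v)$ for all $u,v\in A^*$. Let $M_\sigma=(m_{ij})_{i,j\in A}$ be its substitution matrix, where $m_{ij}$ is the number of letters $i$ in $\sigma(j)$. Assume that 1. $\sigma$ is primitive: some power $M_\sigma^k$, $k\ge 1$, has only positive entries; 2. $\sigma$ is a Pisot substitution: $M_\sigma$ has a simple real eigenvalue greater than $1$, and all other (complex) eigenvalues have absolute value less than $1$ (the eigenvalue $0$ is allowed); 3. $M_\sigma$ is diagonalizable over $\mathbb{C}$. Let $\lambda$ be the Perron–Frobenius eigenvalue of $M_\sigma$, i.e. its positive real eigenvalue such that all other eigenvalues are strictly smaller in absolute value, and let $(\ell_a)_{a\in A}$ be natural tile lengths, i.e. a left eigenvector of $M_\sigma$ for $\lambda$ with positive entries. The geometric hull $\mathbb{X}_\sigma$ is the set of all point sets $\Lambda=\{x_k : k\in\mathbb{Z}\}\subset\mathbb{R}$ with $x_0=0$ and $x_{k+1}=x_k+\ell_{u_k}$ for all $k\in\mathbb{Z}$, where $u=(u_k)_{k\in\mathbb{Z}}\in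 A^{\mathbb{Z}}$ is a bi-infinite word each of whose finite subwords is contained in $\sigma^k(a)$ for some $k\ge 0$ and $a\in A$. Then for every $\Lambda\in\mathbb{X}_\sigma$ the density $$\operatorname{dens}(\Lambda)=\lim_{n\to\infty}\frac{1}{2n}\,\bigl|\Lambda\cap[-n,n]\bigr|$$ exists and is positive, and $\Lambda$ is bounded distance equivalent to the lattice $\operatorname{dens}(\Lambda)^{-1}\mathbb{Z}$: there are a constant $c>0$ and a bijection $\phi\colon\Lambda\to\operatorname{dens}(\Lambda)^{-1}\mathbb{Z}$ such that $|x-\phi(x)|<c$ for all $x\in\Lambda$. -/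

import Mathlib

open Filter Topology

/-- A symbolic substitution over the alphabet `A`: a map `σ` from the finite words over `A` to the
finite words over `A` with `σ(uv) = σ(u)σ(v)`. -/
abbrev Substitution (A : Type*) : Type _ := Monoid.End (FreeMonoid A)

namespace Substitution

variable {A : Type*}

/-- The word `σ^k(a)`, as a list of letters. -/
def iter (σ : Substitution A) (k : ℕ) (a : A) : List A :=
  FreeMonoid.toList ((σ ^ k) (FreeMonoid.of a))

/-- The finite subword `u_p u_{p+1} ⋯ u_{p+m-1}` of the bi-infinite word `u`. -/
def subword (u : ℤ → A) (p : ℤ) (m : ℕ) : List A :=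
  (List.range m).map fun j => u (p + (j : ℤ))

/-- The symbolic hull: all bi-infinite words each of whose finite subwords is contained in some
`σ^k(a)`. -/
def symbolicHull (σ : Substitution A) : Set (ℤ → A) :=
  {u | ∀ (p : ℤ) (m : ℕ), ∃ (k : ℕ) (a : A), subword u p m <:+: σ.iter k a}

/-- The substitution matrix: the entry at `(i, j)` is the number of letters `i` in `σ(j)`. -/
def matrix [DecidableEq A] (σ : Substitution A) : Matrix A A ℕ :=
  Matrix.of fun i j => (σ.iter 1 j).count i

/-- The substitution matrix with real entries. -/
def realMatrix [DecidableEq A] (σ : Substitution A) : Matrix A A ℝ :=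
  σ.matrix.map (Nat.cast : ℕ → ℝ)

/-- The substitution matrix with complex entries. -/
def complexMatrix [DecidableEq A] (σ : Substitution A) : Matrix A A ℂ :=
  σ.matrix.map (Nat.cast : ℕ → ℂ)

variable [Fintype A] [DecidableEq A]

/-- `z` is a (complex) eigenvalue of the substitution matrix. -/
def IsEigenvalue (σ : Substitution A) (z : ℂ) : Prop :=
  Module.End.HasEigenvalue (Matrix.toLin' σ.complexMatrix) z

/-- A substitution is primitive if some power of its matrix has only positive entries. -/
def IsPrimitive (σ : Substitution A) : Prop :=
  σ.realMatrix.IsPrimitive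

/-- The substitution matrix has a simple real eigenvalue `lam > 1`, and all other eigenvalues,
real or complex, have absolute value less than `1` (the value `0` is allowed). -/
def IsPisot (σ : Substitution A) : Prop :=
  ∃ lam : ℝ, 1 < lam ∧ σ.IsEigenvalue (lam : ℂ) ∧
    σ.complexMatrix.charpoly.rootMultiplicity (lam : ℂ) = 1 ∧
    ∀ z : ℂ, σ.IsEigenvalue z → z ≠ (lam : ℂ) → ‖z‖ < 1

/-- `lam` is the Perron-Frobenius eigenvalue of the substitution matrix: a positive real eigenvalue
such that all other eigenvalues are strictly smaller in absolute value. -/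
def IsPerronFrobeniusEigenvalue (σ : Substitution A) (lam : ℝ) : Prop :=
  0 < lam ∧ σ.IsEigenvalue (lam : ℂ) ∧
    ∀ z : ℂ, σ.IsEigenvalue z → z ≠ (lam : ℂ) → ‖z‖ < lam

/-- `l` is a vector of natural tile lengths: a left eigenvector, with positive entries, of the
substitution matrix for the Perron-Frobenius eigenvalue. -/
def IsNaturalTileLengths (σ : Substitution A) (l : A → ℝ) : Prop :=
  (∀ a, 0 < l a) ∧ ∃ lam : ℝ, σ.IsPerronFrobeniusEigenvalue lam ∧
    Matrix.vecMul l σ.realMatrix = lam • l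

/-- The geometric hull for the tile lengths `l`: all sets of left endpoints
`{…, x₋₁, x₀ = 0, x₁, …}` of the tilings of the line obtained from a word `u` in the symbolic hull
by replacing each letter `u_k` by a tile of length `l (u_k)`. -/
def geometricHull (σ : Substitution A) (l : A → ℝ) : Set (Set ℝ) :=
  {Λ | ∃ u ∈ σ.symbolicHull, ∃ x : ℤ → ℝ,
    x 0 = 0 ∧ (∀ k : ℤ, x (k + 1) = x k + l (u k)) ∧ Λ = Set.range x}

/-- The substitution matrix is diagonalizable over `ℂ`. -/
def IsDiagonalizable (σ : Substitution A) : Prop :=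
  ∃ (P : (Matrix A A ℂ)ˣ) (d : A → ℂ),
    σ.complexMatrix = (P : Matrix A A ℂ) * Matrix.diagonal d * ((P⁻¹ : (Matrix A A ℂ)ˣ) : Matrix A A ℂ)

end Substitution

/-- Bounded distance equivalence of two point sets on the line. -/
def BoundedDistanceEquivalent (Λ Λ' : Set ℝ) : Prop :=
  ∃ c : ℝ, 0 < c ∧ ∃ φ : Λ ≃ Λ', ∀ x : Λ, |(x : ℝ) - (φ x : ℝ)| < c

/-- The locally finite set `Λ ⊆ ℝ` has (central) density `d`. -/
def HasDensity (Λ : Set ℝ) (d : ℝ) : Prop :=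
  (∀ n : ℕ, (Λ ∩ Set.Icc (-(n : ℝ)) (n : ℝ)).Finite) ∧
    Tendsto (fun n : ℕ => 1 / (2 * (n : ℝ)) * ((Λ ∩ Set.Icc (-(n : ℝ)) (n : ℝ)).ncard : ℝ))
      atTop (𝓝 d)

/-- The one-dimensional lattice `aℤ`. -/
def latticeZ (a : ℝ) : Set ℝ := Set.range fun n : ℤ => a * (n : ℝ)

open Matrix

namespace Substitution

/-! Give each letter `a` the weight `1 - b * l a`, with `b` chosen so that this row vector has no
component along the Perron–Frobenius eigenvalue. The weight of `σ^k(a)` then combines `k`-th powers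
of eigenvalues of modulus below `1`, so it is summable in `k`
(`exists_summable_abs_wordSum_iter_le`). Cutting a prefix of `σ^k(a)` level by level into boundedly
many blocks `σ^j(c)` per level bounds the weight of every legal word
(`exists_abs_wordSum_infix_iter_le`). For subwords of `u` starting or ending at the origin this says
that `k - b * x k` is bounded, so the density is `b` and `x k ↦ k / b` is the required bijection. -/

/-- The sum of the weights `h a` over the letters `a` of the word `w`. -/
def wordSum {A R : Type*} [AddMonoid R] (h : A → R) (w : List A) : R := (w.map h).sum

/-! ### Additive weights of words under a substitution -/

section WordSum

variable {A R : Type*}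

@[simp] theorem wordSum_nil [AddMonoid R] (h : A → R) : wordSum h [] = 0 := rfl

@[simp] theorem wordSum_cons [AddMonoid R] (h : A → R) (a : A) (w : List A) :
    wordSum h (a :: w) = h a + wordSum h w := by simp [wordSum]

@[simp] theorem wordSum_append [AddMonoid R] (h : A → R) (v w : List A) :
    wordSum h (v ++ w) = wordSum h v + wordSum h w := by simp [wordSum]

theorem wordSum_eq_sum_count [Fintype A] [DecidableEq A] [CommSemiring R] (h : A → R)
    (w : List A) : wordSum h w = ∑ i, h i * (w.count i : R) := by
  induction w with
  | nil => simp
  | cons a w ih =>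
    simp [ih, List.count_cons, mul_add, Finset.sum_add_distrib, add_comm]

theorem map_cons_toList (φ : Substitution A) (a : A) (w : List A) :
    FreeMonoid.toList (φ (FreeMonoid.ofList (a :: w))) =
      FreeMonoid.toList (φ (FreeMonoid.of a)) ++ FreeMonoid.toList (φ (FreeMonoid.ofList w)) := by
  rw [FreeMonoid.ofList_cons, map_mul, FreeMonoid.toList_mul]

theorem wordSum_map [Fintype A] [DecidableEq A] [CommSemiring R] (σ : Substitution A)
    (h : A → R) (w : List A) :
    wordSum h (FreeMonoid.toList (σ (FreeMonoid.ofList w))) =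
      wordSum (h ᵥ* σ.matrix.map (Nat.cast : ℕ → R)) w := by
  induction w with
  | nil => simp
  | cons a w ih =>
    rw [map_cons_toList, wordSum_append, ih, wordSum_cons, wordSum_eq_sum_count]
    simp [vecMul, dotProduct, matrix, iter]

theorem wordSum_pow_map [Fintype A] [DecidableEq A] [CommSemiring R] (σ : Substitution A)
    (h : A → R) (k : ℕ) (w : List A) :
    wordSum h (FreeMonoid.toList ((σ ^ k) (FreeMonoid.ofList w))) =
      wordSum (h ᵥ* (σ.matrix.map (Nat.cast : ℕ → R)) ^ k) w := by
  induction k generalizing w with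
  | zero => simp
  | succ k ih =>
    have : (σ ^ (k + 1)) (FreeMonoid.ofList w) =
        (σ ^ k) (FreeMonoid.ofList (FreeMonoid.toList (σ (FreeMonoid.ofList w)))) := by
      rw [pow_succ]; simp
    rw [this, ih, wordSum_map, vecMul_vecMul, pow_succ]

theorem wordSum_iter [Fintype A] [DecidableEq A] [CommSemiring R] (σ : Substitution A)
    (h : A → R) (k : ℕ) (a : A) :
    wordSum h (σ.iter k a) = (h ᵥ* (σ.matrix.map (Nat.cast : ℕ → R)) ^ k) a := by
  have := wordSum_pow_map σ h k [a]
  simpa [iter] using this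

theorem iter_succ (σ : Substitution A) (k : ℕ) (a : A) :
    σ.iter (k + 1) a = FreeMonoid.toList ((σ ^ k) (FreeMonoid.ofList (σ.iter 1 a))) := by
  simp [iter, pow_succ]

end WordSum

/-! ### Bounded discrepancy of legal words -/

section Discrepancy

variable {A : Type*}

/-- A prefix of `φ(w)` consists of `φ(v)` for a prefix `v` of `w` and of a prefix of the image of
one letter. -/
theorem exists_prefix_abs_wordSum_sub_le (φ : Substitution A) (f : A → ℝ) {B : ℝ} (hB : 0 ≤ B)
    (hφ : ∀ a p, p <+: FreeMonoid.toList (φ (FreeMonoid.of a)) → |wordSum f p| ≤ B)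
    (w p : List A) (hp : p <+: FreeMonoid.toList (φ (FreeMonoid.ofList w))) :
    ∃ v, v <+: w ∧
      |wordSum f p - wordSum f (FreeMonoid.toList (φ (FreeMonoid.ofList v)))| ≤ B := by
  induction w generalizing p with
  | nil =>
    refine ⟨[], List.prefix_rfl, ?_⟩
    have : p = [] := by simpa using hp
    simpa [this] using hB
  | cons a w ih =>
    rw [map_cons_toList] at hp
    rcases List.prefix_or_prefix_of_prefix hp (List.prefix_append _ _) with h | ⟨q, rfl⟩
    · exact ⟨[], List.nil_prefix, by simpa using hφ a p h⟩
    · obtain ⟨v, hv, hvB⟩ := ih q ((List.prefix_append_right_inj _).1 hp)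
      refine ⟨a :: v, by simpa using hv, ?_⟩
      rw [map_cons_toList, wordSum_append, wordSum_append, add_sub_add_left_eq_sub]
      exact hvB

theorem abs_wordSum_map_le (φ : Substitution A) (f : A → ℝ) {G : ℝ}
    (hφ : ∀ a, |wordSum f (FreeMonoid.toList (φ (FreeMonoid.of a)))| ≤ G) (w : List A) :
    |wordSum f (FreeMonoid.toList (φ (FreeMonoid.ofList w)))| ≤ w.length * G := by
  induction w with
  | nil => simp
  | cons a w ih =>
    rw [map_cons_toList, wordSum_append]
    refine (abs_add_le _ _).trans ((add_le_add (hφ a) ih).trans (le_of_eq ?_))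
    push_cast [List.length_cons]
    ring

/-- Since `σ^(k+1)(a) = σ^k(σ(a))`, a prefix is `σ^k(v)`, with `v` a prefix of `σ(a)`, followed by a
prefix of some `σ^k(c)`. The first piece costs at most `L * g k`; the second is the induction
hypothesis. -/
theorem abs_wordSum_prefix_iter_le (σ : Substitution A) (f : A → ℝ) {g : ℕ → ℝ} {L : ℝ}
    (hL : ∀ a, ((σ.iter 1 a).length : ℝ) ≤ L) (hL0 : 0 ≤ L) (hg0 : ∀ k, 0 ≤ g k)
    (hg : ∀ k a, |wordSum f (σ.iter k a)| ≤ g k) (k : ℕ) (a : A) (p : List A)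
    (hp : p <+: σ.iter k a) : |wordSum f p| ≤ g 0 + L * ∑ j ∈ Finset.range k, g j := by
  induction k generalizing a p with
  | zero =>
    have h1 : σ.iter 0 a = [a] := by simp [iter]
    have h2 := hg 0 a
    rw [h1] at hp h2
    rcases List.prefix_cons_iff.1 hp with rfl | ⟨t, rfl, ht⟩
    · simpa using hg0 0
    · have : t = [] := by simpa using ht
      subst this
      simpa using h2
  | succ k ih =>
    rw [iter_succ] at hp
    obtain ⟨v, hv, hvB⟩ := exists_prefix_abs_wordSum_sub_le (σ ^ k) f
      (add_nonneg (hg0 0) (mul_nonneg hL0 (Finset.sum_nonneg fun j _ => hg0 j)))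
      (fun b q hq => ih b q hq) _ p hp
    have h1 := abs_wordSum_map_le (σ ^ k) f (G := g k) (fun b => hg k b) v
    have h2 : (v.length : ℝ) * g k ≤ L * g k := by
      refine mul_le_mul_of_nonneg_right (le_trans ?_ (hL a)) (hg0 k)
      exact_mod_cast hv.length_le
    rw [Finset.sum_range_succ, mul_add]
    have h3 := abs_sub_abs_le_abs_sub (wordSum f p)
      (wordSum f (FreeMonoid.toList ((σ ^ k) (FreeMonoid.ofList v))))
    linarith

theorem exists_abs_wordSum_infix_iter_le [Finite A] (σ : Substitution A) (f : A → ℝ) {g : ℕ → ℝ}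
    (hgs : Summable g) (hg : ∀ k a, |wordSum f (σ.iter k a)| ≤ g k) :
    ∃ C : ℝ, ∀ k a w, w <:+: σ.iter k a → |wordSum f w| ≤ C := by
  rcases isEmpty_or_nonempty A with hA | ⟨⟨a₀⟩⟩
  · exact ⟨0, fun _ a => isEmptyElim a⟩
  have hg0 : ∀ k, 0 ≤ g k := fun k => (abs_nonneg _).trans (hg k a₀)
  obtain ⟨L, hL⟩ := (Set.finite_range fun a => ((σ.iter 1 a).length : ℝ)).bddAbove
  have hL' : ∀ a, ((σ.iter 1 a).length : ℝ) ≤ L := fun a => hL ⟨a, rfl⟩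
  have hL0 : 0 ≤ L := (Nat.cast_nonneg _).trans (hL' a₀)
  have hpre : ∀ k a p, p <+: σ.iter k a → |wordSum f p| ≤ g 0 + L * ∑' j, g j := by
    intro k a p hp
    refine (abs_wordSum_prefix_iter_le σ f hL' hL0 hg0 hg k a p hp).trans ?_
    gcongr
    exact hgs.sum_le_tsum _ fun j _ => hg0 j
  -- The weight of a factor is the difference of the weights of two prefixes, hence the `2`.
  refine ⟨2 * (g 0 + L * ∑' j, g j), ?_⟩
  rintro k a w ⟨s, t, hst⟩
  have h1 := hpre k a (s ++ w) ⟨t, hst⟩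
  have h2 := hpre k a s ⟨w ++ t, by rw [← hst, List.append_assoc]⟩
  rw [wordSum_append] at h1
  rw [abs_le] at *
  constructor <;> linarith [h1.1, h1.2, h2.1, h2.2]

theorem wordSum_subword {u : ℤ → A} {l : A → ℝ} {x : ℤ → ℝ}
    (hx : ∀ k : ℤ, x (k + 1) = x k + l (u k)) (p : ℤ) (m : ℕ) :
    wordSum l (subword u p m) = x (p + m) - x p := by
  induction m with
  | zero => simp [subword]
  | succ m ih =>
    have : subword u p (m + 1) = subword u p m ++ [u (p + m)] := by
      simp [subword, List.range_succ]
    rw [this, wordSum_append, ih, wordSum_cons, wordSum_nil]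
    push_cast
    rw [← add_assoc p, hx]
    ring

end Discrepancy

/-! ### Spectral decay of the weights -/

section Spectral

variable {A : Type*} [Fintype A] [DecidableEq A]

theorem vecMul_conj_pow {R : Type*} [CommRing R] (h : A → R) (P : (Matrix A A R)ˣ) (d : A → R)
    (k : ℕ) (a : A) :
    (h ᵥ* ((P : Matrix A A R) * diagonal d * ((P⁻¹ : (Matrix A A R)ˣ) : Matrix A A R)) ^ k) a =
      ∑ i, (h ᵥ* (P : Matrix A A R)) i * d i ^ k * ((P⁻¹ : (Matrix A A R)ˣ) : Matrix A A R) i a := by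
  rw [Units.conj_pow, diagonal_pow, ← vecMul_vecMul, ← vecMul_vecMul]
  change ∑ i, _ * _ = _
  simp only [vecMul_diagonal, Pi.pow_apply]

/-- The columns of `P` are eigenvectors. -/
theorem isEigenvalue_of_eq_conj_diagonal (σ : Substitution A) {P : (Matrix A A ℂ)ˣ} {d : A → ℂ}
    (h : σ.complexMatrix = (P : Matrix A A ℂ) * diagonal d *
      ((P⁻¹ : (Matrix A A ℂ)ˣ) : Matrix A A ℂ)) (i : A) : σ.IsEigenvalue (d i) := by
  refine Module.End.hasEigenvalue_of_hasEigenvector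
    (x := (P : Matrix A A ℂ) *ᵥ Pi.single i 1) ⟨?_, ?_⟩
  · rw [Module.End.mem_eigenspace_iff, toLin'_apply, h, mulVec_mulVec, Matrix.mul_assoc,
      Matrix.mul_assoc]
    simp only [Units.inv_mul, Matrix.mul_one]
    rw [← mulVec_mulVec, ← mulVec_smul]
    congr 1
    ext j
    by_cases hj : j = i <;> simp [mulVec_diagonal, hj]
  · intro h0
    have h1 := congrArg (fun v => ((P⁻¹ : (Matrix A A ℂ)ˣ) : Matrix A A ℂ) *ᵥ v) h0
    simp only [mulVec_mulVec, Units.inv_mul, one_mulVec, mulVec_zero] at h1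
    simpa using congrFun h1 i

theorem existsUnique_of_rootMultiplicity_charpoly_eq_one {K : Type*} [Field K] [DecidableEq K]
    (P : (Matrix A A K)ˣ) (d : A → K) {z : K}
    (hz : ((P : Matrix A A K) * diagonal d *
      ((P⁻¹ : (Matrix A A K)ˣ) : Matrix A A K)).charpoly.rootMultiplicity z = 1) :
    ∃! i, d i = z := by
  rw [coe_units_inv, charpoly_units_conj] at hz
  have h1 : (diagonal d).charpoly = ((Finset.univ.val.map d).map fun a =>
      (Polynomial.X - Polynomial.C a)).prod := by
    rw [charpoly_diagonal, Multiset.map_map]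
    rfl
  rw [h1, ← Polynomial.count_roots,
    Polynomial.roots_multiset_prod_X_sub_C, Multiset.count_map] at hz
  obtain ⟨i, hi⟩ := Multiset.card_eq_one.1 hz
  have hmem : ∀ j, z = d j ↔ j = i := fun j => by
    have := congrArg (j ∈ ·) hi
    simpa using this
  exact ⟨i, ((hmem i).2 rfl).symm, fun j hj => (hmem j).1 hj.symm⟩

/-- For a diagonalizable Pisot substitution, the number of letters of `σ^k(a)` is `b` times its
length for natural tile lengths, up to a summable error. -/
theorem exists_summable_abs_wordSum_iter_le (σ : Substitution A) (hpisot : σ.IsPisot)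
    (hdiag : σ.IsDiagonalizable) (l : A → ℝ) (hl : σ.IsNaturalTileLengths l) :
    ∃ b : ℝ, 0 < b ∧ ∃ g : ℕ → ℝ, Summable g ∧
      ∀ k a, |wordSum (fun a => 1 - b * l a) (σ.iter k a)| ≤ g k := by
  classical
  obtain ⟨lam, hlam1, -, hmult, hsmall⟩ := hpisot
  obtain ⟨hlpos, lam', ⟨hlam'0, hlam'ev, hlam'⟩, hlM⟩ := hl
  obtain ⟨P, d, hPd⟩ := hdiag
  rw [hPd] at hmult
  obtain ⟨e, hde, heu⟩ := existsUnique_of_rootMultiplicity_charpoly_eq_one P d hmult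
  have hev := isEigenvalue_of_eq_conj_diagonal σ hPd
  -- If they differed, `lam < lam'` by dominance of `lam'`, while the Pisot condition gives `lam' <
  -- 1 < lam`.
  have hlameq : lam' = lam := by
    by_contra hne
    have h1 := hlam' (lam : ℂ) (hde ▸ hev e) (by exact_mod_cast Ne.symm hne)
    have h2 := hsmall lam' hlam'ev (by exact_mod_cast hne)
    rw [Complex.norm_real, Real.norm_eq_abs] at h1 h2
    linarith [le_abs_self lam, le_abs_self lam']
  subst hlameq
  have hd : ∀ i, i ≠ e → ‖d i‖ < 1 := fun i hi => hsmall _ (hev i) fun h => hi (heu i h)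
  set lc : A → ℂ := fun a => (l a : ℂ) with hlc
  have hlcM : lc ᵥ* σ.complexMatrix = (lam' : ℂ) • lc := by
    ext a
    have := congrArg (fun r : ℝ => (r : ℂ)) (congrFun hlM a)
    simpa [vecMul, dotProduct, realMatrix, complexMatrix, hlc] using this
  -- A left eigenvector annihilates right eigenvectors of other eigenvalues.
  have hlP : ∀ i, i ≠ e → (lc ᵥ* (P : Matrix A A ℂ)) i = 0 := by
    intro i hi
    have h1 : (lc ᵥ* (P : Matrix A A ℂ)) ᵥ* diagonal d =
        (lam' : ℂ) • (lc ᵥ* (P : Matrix A A ℂ)) := by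
      rw [← smul_vecMul, ← hlcM, hPd, vecMul_vecMul, vecMul_vecMul, Matrix.mul_assoc,
        Units.inv_mul, Matrix.mul_one]
    have h2 := congrFun h1 i
    rw [vecMul_diagonal, Pi.smul_apply, smul_eq_mul, mul_comm, ← sub_eq_zero, ← sub_mul] at h2
    rcases mul_eq_zero.1 h2 with h | h
    · exact absurd (heu i (sub_eq_zero.1 h)) hi
    · exact h
  have hlPe : (lc ᵥ* (P : Matrix A A ℂ)) e ≠ 0 := by
    intro h0
    have h1 : lc ᵥ* (P : Matrix A A ℂ) = 0 := by
      ext i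
      by_cases hi : i = e
      · rw [hi, h0]; rfl
      · exact hlP i hi
    have h2 : lc = 0 := by
      have := congrArg (fun v => v ᵥ* ((P⁻¹ : (Matrix A A ℂ)ˣ) : Matrix A A ℂ)) h1
      simpa [vecMul_vecMul] using this
    have h3 := congrFun h2 e
    simp [hlc, (hlpos e).ne'] at h3
  -- This `β` cancels the component of `1 - β • lc` at `e`. Only its real part is needed, the
  -- lengths being real.
  set β : ℂ := ((1 : A → ℂ) ᵥ* (P : Matrix A A ℂ)) e / (lc ᵥ* (P : Matrix A A ℂ)) e with hβ
  set h : A → ℂ := 1 - β • lc with hh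
  have hhP : (h ᵥ* (P : Matrix A A ℂ)) e = 0 := by
    rw [hh, sub_vecMul, smul_vecMul, Pi.sub_apply, Pi.smul_apply, smul_eq_mul, hβ,
      div_mul_cancel₀ _ hlPe, sub_self]
  set g : ℕ → ℝ := fun k => ∑ a, ‖wordSum h (σ.iter k a)‖ with hg
  have hre : ∀ w, wordSum (fun a => 1 - β.re * l a) w = (wordSum h w).re := by
    intro w
    induction w with
    | nil => simp
    | cons a w ih => simp [ih, hh, hlc]
  have hgle : ∀ k a, |wordSum (fun a => 1 - β.re * l a) (σ.iter k a)| ≤ g k := by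
    intro k a
    rw [hre]
    refine (Complex.abs_re_le_norm _).trans ?_
    exact Finset.single_le_sum (f := fun a => ‖wordSum h (σ.iter k a)‖)
      (fun _ _ => norm_nonneg _) (Finset.mem_univ a)
  have hgs : Summable g := by
    refine summable_sum fun a _ => ?_
    refine Summable.of_nonneg_of_le (fun _ => norm_nonneg _) (f := fun k =>
      ∑ i, ‖(h ᵥ* (P : Matrix A A ℂ)) i‖ * ‖d i‖ ^ k *
        ‖((P⁻¹ : (Matrix A A ℂ)ˣ) : Matrix A A ℂ) i a‖) (fun k => ?_) ?_
    · rw [wordSum_iter]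
      change ‖(h ᵥ* σ.complexMatrix ^ k) a‖ ≤ _
      rw [hPd, vecMul_conj_pow]
      refine (norm_sum_le _ _).trans (le_of_eq ?_)
      simp
    · refine summable_sum fun i _ => ?_
      by_cases hi : i = e
      · simp [hi, hhP, summable_zero]
      · exact ((summable_geometric_of_lt_one (norm_nonneg _) (hd i hi)).mul_left _).mul_right _
  refine ⟨β.re, ?_, g, hgs, hgle⟩
  -- If `b ≤ 0`, every letter weighs at least `1 ≥ l a / L`, so `σ^k(e)` weighs at least `lam' ^ k *
  -- l e / L ≥ l e / L`, contradicting `g → 0`.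
  by_contra! hb
  obtain ⟨L, hL⟩ := (Set.finite_range l).bddAbove
  have hLpos : 0 < L := (hlpos e).trans_le (hL ⟨e, rfl⟩)
  have hiter : ∀ k, wordSum l (σ.iter k e) = lam' ^ k * l e := by
    intro k
    rw [wordSum_iter]
    change (l ᵥ* σ.realMatrix ^ k) e = _
    have : l ᵥ* σ.realMatrix ^ k = lam' ^ k • l := by
      induction k with
      | zero => simp
      | succ k ih => rw [pow_succ, ← vecMul_vecMul, ih, smul_vecMul, hlM, smul_smul, pow_succ]
    rw [this, Pi.smul_apply, smul_eq_mul]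
  have hle : ∀ w, wordSum l w ≤ L * wordSum (fun a => 1 - β.re * l a) w := by
    intro w
    induction w with
    | nil => simp
    | cons a w ih =>
      rw [wordSum_cons, wordSum_cons, mul_add]
      refine add_le_add ((hL ⟨a, rfl⟩).trans ?_) ih
      refine le_mul_of_one_le_right hLpos.le ?_
      linarith [mul_nonpos_of_nonpos_of_nonneg hb (hlpos a).le]
  have hlow : ∀ k, l e / L ≤ g k := by
    intro k
    rw [div_le_iff₀' hLpos]
    calc l e ≤ lam' ^ k * l e := le_mul_of_one_le_left (hlpos e).le (one_le_pow₀ hlam1.le)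
      _ = wordSum l (σ.iter k e) := (hiter k).symm
      _ ≤ _ := hle _
      _ ≤ L * g k := by gcongr; exact (le_abs_self _).trans (hgle k e)
  exact (div_pos (hlpos e) hLpos).not_ge (ge_of_tendsto' hgs.tendsto_atTop_zero hlow)

end Spectral

end Substitution

/-! ### Point sets at bounded distance from a lattice -/

section Density

/-- The lower bound must allow `r < 0`, because it is used at `b * n - C`. -/
theorem ncard_abs_intCast_le_bounds {r : ℝ} :
    2 * r - 1 ≤ ({k : ℤ | |(k : ℝ)| ≤ r}.ncard : ℝ) ∧
      (0 ≤ r → ({k : ℤ | |(k : ℝ)| ≤ r}.ncard : ℝ) ≤ 2 * r + 1) := by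
  have h1 : {k : ℤ | |(k : ℝ)| ≤ r} = Finset.Icc (-⌊r⌋) ⌊r⌋ := by
    ext k
    simp only [Set.mem_ofPred_eq, Finset.coe_Icc, Set.mem_Icc, abs_le, neg_le (a := ⌊r⌋),
      Int.le_floor, Int.cast_neg, neg_le (a := r)]
  rw [h1, Set.ncard_coe_finset, Int.card_Icc]
  have h2 : ((⌊r⌋ + 1 - -⌊r⌋ : ℤ) : ℝ) ≤ ((⌊r⌋ + 1 - -⌊r⌋).toNat : ℝ) := by
    exact_mod_cast Int.self_le_toNat _
  have h3 := Int.lt_floor_add_one r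
  push_cast at h2
  refine ⟨by linarith, fun hr => ?_⟩
  have h4 : ((⌊r⌋ + 1 - -⌊r⌋).toNat : ℤ) = ⌊r⌋ + 1 - -⌊r⌋ :=
    Int.toNat_of_nonneg (by linarith [Int.floor_nonneg.2 hr])
  have h5 : ((⌊r⌋ + 1 - -⌊r⌋).toNat : ℝ) = ((⌊r⌋ + 1 - -⌊r⌋ : ℤ) : ℝ) := by exact_mod_cast h4
  rw [h5]
  push_cast
  linarith [Int.floor_le r]

theorem finite_abs_intCast_le (r : ℝ) : {k : ℤ | |(k : ℝ)| ≤ r}.Finite := by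
  refine (Set.finite_Icc (-⌊r⌋) ⌊r⌋).subset fun k hk => ?_
  rw [Set.mem_Icc, neg_le, Int.le_floor, Int.le_floor, Int.cast_neg, neg_le]
  exact abs_le.1 hk

theorem hasDensity_range {x : ℤ → ℝ} (hinj : Function.Injective x) {b C : ℝ} (hb : 0 < b)
    (hC : ∀ k : ℤ, |(k : ℝ) - b * x k| ≤ C) : HasDensity (Set.range x) b := by
  have hC0 : 0 ≤ C := (abs_nonneg _).trans (hC 0)
  have himage : ∀ n : ℕ, Set.range x ∩ Set.Icc (-(n : ℝ)) n = x '' {k | |x k| ≤ n} := by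
    intro n
    ext y
    simp only [Set.mem_inter_iff, Set.mem_range, Set.mem_Icc, ← abs_le, Set.mem_image,
      Set.mem_ofPred_eq]
    constructor
    · rintro ⟨⟨k, rfl⟩, hk⟩
      exact ⟨k, hk, rfl⟩
    · rintro ⟨k, hk, rfl⟩
      exact ⟨⟨k, rfl⟩, hk⟩
  have hupper : ∀ n : ℕ, {k : ℤ | |x k| ≤ n} ⊆ {k : ℤ | |(k : ℝ)| ≤ b * n + C} := by
    intro n k hk
    have h1 := abs_sub_abs_le_abs_sub (k : ℝ) (b * x k)
    rw [abs_mul, abs_of_pos hb] at h1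
    have h2 : b * |x k| ≤ b * n := mul_le_mul_of_nonneg_left hk hb.le
    simp only [Set.mem_ofPred_eq]
    linarith [hC k]
  have hlower : ∀ n : ℕ, {k : ℤ | |(k : ℝ)| ≤ b * n - C} ⊆ {k : ℤ | |x k| ≤ n} := by
    intro n k hk
    have h1 := abs_sub_abs_le_abs_sub (b * x k) (k : ℝ)
    rw [abs_mul, abs_of_pos hb, abs_sub_comm] at h1
    simp only [Set.mem_ofPred_eq] at hk ⊢
    refine le_of_mul_le_mul_left ?_ hb
    linarith [hC k]
  have hfin : ∀ n : ℕ, {k : ℤ | |x k| ≤ n}.Finite := fun n =>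
    (finite_abs_intCast_le _).subset (hupper n)
  refine ⟨fun n => by rw [himage]; exact (hfin n).image _, ?_⟩
  have hbound : ∀ n : ℕ,
      |((Set.range x ∩ Set.Icc (-(n : ℝ)) n).ncard : ℝ) - 2 * b * n| ≤ 2 * C + 1 := by
    intro n
    rw [himage, Set.ncard_image_of_injective _ hinj]
    have h1 : ({k : ℤ | |x k| ≤ n}.ncard : ℝ) ≤
        ({k : ℤ | |(k : ℝ)| ≤ b * n + C}.ncard : ℝ) := by
      exact_mod_cast Set.ncard_le_ncard (hupper n) (finite_abs_intCast_le _)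
    have h2 : ({k : ℤ | |(k : ℝ)| ≤ b * n - C}.ncard : ℝ) ≤
        ({k : ℤ | |x k| ≤ n}.ncard : ℝ) := by
      exact_mod_cast Set.ncard_le_ncard (hlower n) (hfin n)
    have h3 := (ncard_abs_intCast_le_bounds (r := b * n + C)).2 (by positivity)
    have h4 := (ncard_abs_intCast_le_bounds (r := b * n - C)).1
    rw [abs_le]
    constructor <;> linarith
  rw [tendsto_iff_norm_sub_tendsto_zero]
  have hlim : Tendsto (fun n : ℕ => (2 * C + 1) / 2 / (n : ℝ)) atTop (𝓝 0) :=
    tendsto_const_div_atTop_nhds_zero_nat _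
  refine squeeze_zero' (Eventually.of_forall fun _ => norm_nonneg _) ?_ hlim
  filter_upwards [eventually_gt_atTop 0] with n hn
  have hn' : (0 : ℝ) < n := by exact_mod_cast hn
  have heq : 1 / (2 * (n : ℝ)) * ((Set.range x ∩ Set.Icc (-(n : ℝ)) n).ncard : ℝ) - b =
      (((Set.range x ∩ Set.Icc (-(n : ℝ)) n).ncard : ℝ) - 2 * b * n) / (2 * n) := by
    field_simp
  rw [heq, Real.norm_eq_abs, abs_div, abs_of_pos (by positivity : (0 : ℝ) < 2 * n), div_div]
  gcongr
  exact hbound n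

theorem boundedDistanceEquivalent_range {x : ℤ → ℝ} (hinj : Function.Injective x) {b C : ℝ}
    (hb : 0 < b) (hC : ∀ k : ℤ, |(k : ℝ) - b * x k| ≤ C) :
    BoundedDistanceEquivalent (Set.range x) (latticeZ b⁻¹) := by
  have hC0 : 0 ≤ C := (abs_nonneg _).trans (hC 0)
  have hinj' : Function.Injective fun n : ℤ => b⁻¹ * (n : ℝ) := fun m n hmn =>
    Int.cast_injective (mul_left_cancel₀ (inv_ne_zero hb.ne') hmn)
  -- Adding `1` makes the inequality strict.
  refine ⟨C / b + 1, by positivity,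
    (Equiv.ofInjective x hinj).symm.trans (Equiv.ofInjective _ hinj'), ?_⟩
  rintro ⟨_, k, rfl⟩
  have h1 : (Equiv.ofInjective x hinj).symm ⟨x k, k, rfl⟩ = k :=
    Equiv.ofInjective_symm_apply hinj k
  have h2 : x k - b⁻¹ * (k : ℝ) = -((k : ℝ) - b * x k) / b := by field_simp; ring
  change |x k - b⁻¹ * (((Equiv.ofInjective x hinj).symm ⟨x k, k, rfl⟩ : ℤ) : ℝ)| < _
  rw [h1, h2, abs_div, abs_neg, abs_of_pos hb]
  have : |(k : ℝ) - b * x k| / b ≤ C / b := by gcongr; exact hC k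
  linarith

end Density

theorem theorem3p6 {A : Type*} [Fintype A] [DecidableEq A] (σ : Substitution A)
    (hprim : σ.IsPrimitive) (hpisot : σ.IsPisot) (hdiag : σ.IsDiagonalizable)
    (l : A → ℝ) (hl : σ.IsNaturalTileLengths l)
    (Λ : Set ℝ) (hΛ : Λ ∈ σ.geometricHull l) :
    ∃ d : ℝ, 0 < d ∧ HasDensity Λ d ∧ BoundedDistanceEquivalent Λ (latticeZ d⁻¹) := by
  obtain ⟨b, hb, g, hgs, hg⟩ := σ.exists_summable_abs_wordSum_iter_le hpisot hdiag l hl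
  obtain ⟨C, hC⟩ := σ.exists_abs_wordSum_infix_iter_le _ hgs hg
  obtain ⟨u, hu, x, hx0, hx, rfl⟩ := hΛ
  have hsub : ∀ (p : ℤ) (m : ℕ), |(m : ℝ) - b * (x (p + m) - x p)| ≤ C := by
    intro p m
    obtain ⟨k, a, hka⟩ := hu p m
    have h1 := hC k a _ hka
    -- The partial sums of the weights `1 - b * l` telescope to `k - b * x k`.
    rwa [Substitution.wordSum_subword (x := fun k => (k : ℝ) - b * x k)
      (fun k => by rw [hx]; push_cast; ring),
      show (((p + m : ℤ) : ℝ) - b * x (p + m) - ((p : ℝ) - b * x p)) =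
        (m : ℝ) - b * (x (p + m) - x p) by push_cast; ring] at h1
  have hdist : ∀ k : ℤ, |(k : ℝ) - b * x k| ≤ C := by
    intro k
    obtain ⟨m, rfl | rfl⟩ := k.eq_nat_or_neg
    · simpa [hx0] using hsub 0 m
    -- A negative index uses the subword that ends at the origin.
    · have h1 := hsub (-m) m
      rw [neg_add_cancel, hx0, ← abs_neg] at h1
      convert h1 using 2
      push_cast
      ring
  have hinj : Function.Injective x :=
    (strictMono_int_of_lt_succ fun k => by rw [hx]; linarith [hl.1 (u k)]).injective
  exact ⟨b, hb, hasDensity_range hinj hb hdist, boundedDistanceEquivalent_range hinj hb hdist⟩
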